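/- Let $n\in\mathbb N$, $A,B\in\mathbb R^{n\times n}$, $b,E\in\mathbb R^n$, $C\in\mathbb R^{1\times n}$, $\underline u<\bar u$ and $\mathcal U=[\underline u,\bar u]$, and let $\mathrm{sat}(s)=\max\{\underline u,\min\{s,\bar u\}\}$. Consider the bilinear system with saturated input and constant reference $r\in\mathbb R$ $$\dot x=Ax+(Bx+b)\,\mathrm{sat}(u)+E,\qquad e=Cx-r,$$ extended with the integral action $\dot z=e$. Write $F_u=A+Bu$, $\pi(u)=-F_u^{-1}(bu+E)$ and $g_u=B\pi(u)+b$. Assume: (a) with $\mu=|B|\max\{|\underline u|,|\bar u|\}$ (where $|B|$ is the matrix norm induced by the Euclidean norm), for every $u\in\mathcal U$ there exist $P=P^\top\succ0$ and $\nu,\epsilon>0$ such that $$\begin{pmatrix}PF_u+F_u^\top P+(\nu\mu^2+2\epsilon)I & P\\ P & -\nu I\end{pmatrix}\preceq 0;$$ (b) for all $u\in\mathcal U$ and all $v\in[\underline u-\bar u,\bar u-\underline u]$, the matrix $F_u+Bv$ is invertible and $C(F_u+Bv)^{-1}g_u\neq0$. Let $u_{ss}\in(\underline u,\bar u)$, $x_{ss}\in\mathbb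 R^n$ and $r\in\mathbb R$ satisfy $0=(A+Bu_{ss})x_{ss}+bu_{ss}+E$ and $0=Cx_{ss}-r$. Then there exists $k_i^*>0$ such that, for every $k_i\in(0,k_i^*)$, the point $(x_{ss},0)$ is a globally asymptotically stable and locally exponentially stable equilibrium of the closed loop with the pure integral feedback $$u=u_{ss}+\mathrm{sgn}\big(CF_{u_{ss}}^{-1}g_{u_{ss}}\big)\,k_i z .$$ -/

import Mathlib

open Matrix Filter Topology

/-! ### Stability of equilibria of `ẋ = f x` -/

section Stability

variable {X : Type*} [NormedAddCommGroup X] [NormedSpace ℝ X]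

/-- `x` is a solution of `ẋ = f x` on `[0, ∞)` (one-sided derivative at `0`). -/
def IsForwardSolution (f : X → X) (x : ℝ → X) : Prop :=
  ∀ t : ℝ, 0 ≤ t → HasDerivWithinAt x (f (x t)) (Set.Ici 0) t

/-- The equilibrium `p` of `ẋ = f x` is globally asymptotically stable: `p` is an equilibrium,
from every initial state there is a solution on `[0, ∞)`, `p` is Lyapunov stable, and every
solution converges to `p`. -/
structure IsGloballyAsymptoticallyStable (f : X → X) (p : X) : Prop where
  equilibrium : f p = 0
  complete : ∀ x₀ : X, ∃ x : ℝ → X, IsForwardSolution f x ∧ x 0 = x₀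
  stable : ∀ ε > 0, ∃ δ > 0, ∀ x : ℝ → X, IsForwardSolution f x → ‖x 0 - p‖ < δ →
    ∀ t : ℝ, 0 ≤ t → ‖x t - p‖ < ε
  attractive : ∀ x : ℝ → X, IsForwardSolution f x → Tendsto x atTop (𝓝 p)

/-- The equilibrium `p` of `ẋ = f x` is locally exponentially stable: `p` is an equilibrium and
there are `δ, K, l > 0` such that, from every initial state in the `δ`-ball around `p`, there is
a solution on `[0, ∞)`, and all such solutions satisfy `‖x t - p‖ ≤ K e^{-l t} ‖x 0 - p‖`. -/
structure IsLocallyExponentiallyStable (f : X → X) (p : X) : Prop where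
  equilibrium : f p = 0
  exponential : ∃ δ > 0, ∃ K > 0, ∃ l > 0,
    (∀ x₀ : X, ‖x₀ - p‖ < δ → ∃ x : ℝ → X, IsForwardSolution f x ∧ x 0 = x₀) ∧
    ∀ x : ℝ → X, IsForwardSolution f x → ‖x 0 - p‖ < δ →
      ∀ t : ℝ, 0 ≤ t → ‖x t - p‖ ≤ K * Real.exp (-l * t) * ‖x 0 - p‖

end Stability

/-! ### Bilinear systems with saturated input -/

/-- The saturation function with lower level `lo` and upper level `hi`. -/
noncomputable def sat (lo hi s : ℝ) : ℝ := max lo (min s hi)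

/-- The data of a single-input single-output bilinear system with saturated input
`ẋ = A x + (B x + b) sat(u) + E`, regulated output `e = C x - r`, and input set
`𝒰 = [lo, hi]`. -/
structure BilinearSystem (n : ℕ) where
  A : Matrix (Fin n) (Fin n) ℝ
  B : Matrix (Fin n) (Fin n) ℝ
  b : Fin n → ℝ
  E : Fin n → ℝ
  C : Fin n → ℝ
  lo : ℝ
  hi : ℝ

namespace BilinearSystem

variable {n : ℕ} (S : BilinearSystem n)

/-- `F_u = A + B u`. -/
noncomputable def F (u : ℝ) : Matrix (Fin n) (Fin n) ℝ := S.A + u • S.B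

/-- The steady-state map `π(u) = -(A + B u)⁻¹ (b u + E)`. -/
noncomputable def steadyState (u : ℝ) : Fin n → ℝ := -((S.F u)⁻¹ *ᵥ (u • S.b + S.E))

/-- `g_u = B π(u) + b`. -/
noncomputable def g (u : ℝ) : Fin n → ℝ := S.B *ᵥ S.steadyState u + S.b

/-- `μ = |B| max {|lo|, |hi|}`, where `|B|` is the matrix norm induced by the Euclidean norm. -/
noncomputable def mu : ℝ :=
  ‖Matrix.toEuclideanCLM (n := Fin n) (𝕜 := ℝ) S.B‖ * max |S.lo| |S.hi|

/-- For every `u ∈ 𝒰` there are `P = Pᵀ ≻ 0` and `ν, ε > 0` such that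
`[P F_u + F_uᵀ P + (ν μ² + 2 ε) I, P; P, -ν I] ⪯ 0`. -/
def RobustStabilityLMI : Prop :=
  ∀ u ∈ Set.Icc S.lo S.hi, ∃ (P : Matrix (Fin n) (Fin n) ℝ) (ν ε : ℝ),
    P.PosDef ∧ 0 < ν ∧ 0 < ε ∧
    (-(Matrix.fromBlocks
        (P * S.F u + (S.F u)ᵀ * P + (ν * S.mu ^ 2 + 2 * ε) • (1 : Matrix (Fin n) (Fin n) ℝ)) P
        P (-(ν • (1 : Matrix (Fin n) (Fin n) ℝ))))).PosSemidef

/-- For all `u ∈ 𝒰` and `v ∈ [lo - hi, hi - lo]`, the matrix `F_u + B v` is invertible and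
`C (F_u + B v)⁻¹ g_u ≠ 0`. (The inverse of a singular matrix is `0` here, so invertibility is
also a consequence of the second part.) -/
def NonzeroGain : Prop :=
  ∀ u ∈ Set.Icc S.lo S.hi, ∀ v ∈ Set.Icc (S.lo - S.hi) (S.hi - S.lo),
    IsUnit (S.F u + v • S.B) ∧ S.C ⬝ᵥ ((S.F u + v • S.B)⁻¹ *ᵥ S.g u) ≠ 0

/-- The regulator equations `0 = (A + B uss) xss + b uss + E` and `0 = C xss - r`. -/
def RegulatorEquations (r : ℝ) (xss : Fin n → ℝ) (uss : ℝ) : Prop :=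
  (S.A + uss • S.B) *ᵥ xss + uss • S.b + S.E = 0 ∧ S.C ⬝ᵥ xss - r = 0

/-- The integral feedback `u = uss + sgn(C F_uss⁻¹ g_uss) k z`. Here `-C F_uss⁻¹ g_uss` is the
DC gain of the linearized plant, so this is negative feedback of `z`. -/
noncomputable def integralFeedback (uss k z : ℝ) : ℝ :=
  uss + Real.sign (S.C ⬝ᵥ ((S.F uss)⁻¹ *ᵥ S.g uss)) * k * z

/-- The vector field of the closed loop `ẋ = A x + (B x + b) sat(u) + E`, `ż = C x - r` with
`u` the integral feedback. All norms on the state space are equivalent, so its stability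
properties do not depend on the choice of one. -/
noncomputable def closedLoop (r uss k : ℝ) (p : (Fin n → ℝ) × ℝ) : (Fin n → ℝ) × ℝ :=
  (S.A *ᵥ p.1 + sat S.lo S.hi (S.integralFeedback uss k p.2) • (S.B *ᵥ p.1 + S.b) + S.E,
    S.C ⬝ᵥ p.1 - r)

end BilinearSystem

/-! ### Lyapunov functions with one-sided derivatives -/

section Lyapunov

variable {X : Type*} [NormedAddCommGroup X] [NormedSpace ℝ X]

/-! For small `k` the integrator is slow, so the plant stays near the frozen equilibrium `π(u)` and
the loop behaves like `ż = C π(u) - r`. Two facts about the plant make this rigorous. (1) The LMI at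
the midpoint of the input interval already gives one matrix `P` with `xᵀ P F_u x ≤ -ε |x|²` for all
`u ∈ 𝒰` (`exists_common_lyapunov`). (2) The identity `π(w) - π(u) = -(w - u) F_w⁻¹ g_u`
(`steadyState_sub`) yields `π' = -F_u⁻¹ g_u` and, since `C F_w⁻¹ g_uss` never vanishes on `𝒰`,
strict monotonicity of the steady-state output about `uss` (`exists_le_sign_mul`).

With `w = uss + σ k z`, `u = sat w` and `y = x - π(u)`, the Lyapunov function is `yᵀ P y + ∫ (sat s
- uss) ds`, the integral running from `uss` to `w`. Its right derivative contains `-2ε|y|²`, at most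
`-kγ(u - uss)²` from the monotonicity, and cross terms of order `k`; Young's inequality absorbs
these for small `k`. The integral is quadratic where `sat` is inactive, which gives exponential
decay there; elsewhere `|y|` or `|u - uss|` is bounded below, so the function falls at a definite
speed until the trajectory enters that region. -/

theorem antitoneOn_of_right_deriv_nonpos {f f' : ℝ → ℝ} (hf : ContinuousOn f (Set.Ici 0))
    (hf' : ∀ t, 0 ≤ t → HasDerivWithinAt f (f' t) (Set.Ici t) t)
    (hle : ∀ t, 0 ≤ t → f' t ≤ 0) : AntitoneOn f (Set.Ici 0) := by
  intro s hs t _ hst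
  have hs0 : (0 : ℝ) ≤ s := hs
  refine image_le_of_deriv_right_le_deriv_boundary (f := f) (f' := f') (a := s) (b := t)
    (B := fun _ => f s) (B' := fun _ => 0) (hf.mono fun u hu => hs0.trans hu.1)
    (fun u hu => hf' u (hs0.trans hu.1)) le_rfl continuousOn_const
    (fun u _ => hasDerivWithinAt_const _ _ _) (fun u hu => hle u (hs0.trans hu.1))
    ⟨hst, le_rfl⟩

theorem IsForwardSolution.continuousOn {f : X → X} {x : ℝ → X} (hx : IsForwardSolution f x) :
    ContinuousOn x (Set.Ici 0) := fun t ht => (hx t ht).continuousWithinAt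

theorem IsForwardSolution.shift {f : X → X} {x : ℝ → X} (hx : IsForwardSolution f x) {T : ℝ}
    (hT : 0 ≤ T) : IsForwardSolution f (fun s => x (T + s)) := by
  intro t ht
  have h := hx (T + t) (by positivity)
  have h2 : HasDerivWithinAt (fun s : ℝ => T + s) 1 (Set.Ici 0) t :=
    ((hasDerivAt_id t).const_add T).hasDerivWithinAt
  have h3 := h.scomp t h2 (fun s (hs : 0 ≤ s) => show 0 ≤ T + s by positivity)
  simpa [Function.comp_def] using h3

/-- `L` decreases along solutions of `ẋ = f x`: exponentially with rate `β` inside the sublevel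
set `{L < θ}`, and at speed at least `η` outside of it. -/
def DecreasesAlongSolutions (f : X → X) (L : X → ℝ) (θ β η : ℝ) : Prop :=
  ∀ x : ℝ → X, IsForwardSolution f x → ∀ t : ℝ, 0 ≤ t →
    ∃ D, HasDerivWithinAt (fun s => L (x s)) D (Set.Ici t) t ∧
      (L (x t) < θ → D ≤ -β * L (x t)) ∧ (θ ≤ L (x t) → D ≤ -η)

variable {f : X → X} {L : X → ℝ} {θ β η : ℝ}

theorem DecreasesAlongSolutions.antitoneOn (hL : DecreasesAlongSolutions f L θ β η)
    (hβ : 0 ≤ β) (hη : 0 ≤ η) (hcont : Continuous L) (hnonneg : ∀ q, 0 ≤ L q)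
    {x : ℝ → X} (hx : IsForwardSolution f x) :
    AntitoneOn (fun t => L (x t)) (Set.Ici 0) := by
  choose! D hD hD1 hD2 using hL x hx
  refine antitoneOn_of_right_deriv_nonpos (hcont.comp_continuousOn hx.continuousOn) hD ?_
  intro t ht
  rcases lt_or_ge (L (x t)) θ with h | h
  · have := hD1 t ht h
    nlinarith [mul_nonneg hβ (hnonneg (x t))]
  · linarith [hD2 t ht h]

theorem DecreasesAlongSolutions.le_exp (hL : DecreasesAlongSolutions f L θ β η)
    (hβ : 0 ≤ β) (hη : 0 ≤ η) (hcont : Continuous L) (hnonneg : ∀ q, 0 ≤ L q)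
    {x : ℝ → X} (hx : IsForwardSolution f x) (h0 : L (x 0) < θ) {t : ℝ} (ht : 0 ≤ t) :
    L (x t) < θ ∧ L (x t) ≤ Real.exp (-β * t) * L (x 0) := by
  have hanti := hL.antitoneOn hβ hη hcont hnonneg hx
  have hlt : ∀ s : ℝ, 0 ≤ s → L (x s) < θ := fun s hs =>
    (hanti (Set.mem_Ici.2 le_rfl) hs hs).trans_lt h0
  refine ⟨hlt t ht, ?_⟩
  choose! D hD hD1 hD2 using hL x hx
  have hexp : ∀ s : ℝ, HasDerivAt (fun s => Real.exp (β * s)) (Real.exp (β * s) * β) s := by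
    intro s
    simpa using ((hasDerivAt_id s).const_mul β).exp
  have hmono : AntitoneOn (fun s => Real.exp (β * s) * L (x s)) (Set.Ici 0) := by
    refine antitoneOn_of_right_deriv_nonpos
      (ContinuousOn.mul (by fun_prop) (hcont.comp_continuousOn hx.continuousOn))
      (fun s hs => (hexp s).hasDerivWithinAt.mul (hD s hs)) ?_
    intro s hs
    have h1 := hD1 s hs (hlt s hs)
    have h2 := Real.exp_pos (β * s)
    nlinarith
  have h := hmono (Set.mem_Ici.2 le_rfl) (Set.mem_Ici.2 ht) ht
  simp only [mul_zero, Real.exp_zero, one_mul] at h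
  calc L (x t) = Real.exp (-β * t) * (Real.exp (β * t) * L (x t)) := by
        rw [← mul_assoc, ← Real.exp_add]; simp
    _ ≤ _ := by gcongr

theorem DecreasesAlongSolutions.exists_lt (hL : DecreasesAlongSolutions f L θ β η)
    (hη : 0 < η) (hcont : Continuous L) (hnonneg : ∀ q, 0 ≤ L q)
    {x : ℝ → X} (hx : IsForwardSolution f x) : ∃ T, 0 ≤ T ∧ L (x T) < θ := by
  by_contra! hcon
  choose! D hD hD1 hD2 using hL x hx
  have hmono : AntitoneOn (fun s => L (x s) + η * s) (Set.Ici 0) := by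
    refine antitoneOn_of_right_deriv_nonpos
      (ContinuousOn.add (hcont.comp_continuousOn hx.continuousOn) (by fun_prop))
      (fun s hs => (hD s hs).add
        (by simpa using ((hasDerivAt_id s).const_mul η).hasDerivWithinAt)) ?_
    intro s hs
    linarith [hD2 s hs (hcon s hs)]
  -- By this time a decrease at speed `η` would bring `L` down to at most `-1`.
  have hT : (0 : ℝ) ≤ (L (x 0) + 1) / η := div_nonneg (by linarith [hnonneg (x 0)]) hη.le
  have h := hmono (Set.mem_Ici.2 le_rfl) (Set.mem_Ici.2 hT) hT
  simp only [mul_zero, add_zero] at h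
  rw [mul_div_cancel₀ _ hη.ne'] at h
  linarith [hnonneg (x ((L (x 0) + 1) / η))]

/-- A continuous Lyapunov function with right derivatives along solutions, quadratically bounded
near `p`, yields global asymptotic and local exponential stability. -/
theorem DecreasesAlongSolutions.stability (hL : DecreasesAlongSolutions f L θ β η) {p : X}
    (hβ : 0 < β) (hη : 0 < η) (hθ : 0 < θ) (hcont : Continuous L) (hnonneg : ∀ q, 0 ≤ L q)
    (heq : f p = 0) (hcomplete : ∀ x₀ : X, ∃ x : ℝ → X, IsForwardSolution f x ∧ x 0 = x₀)
    {c₁ c₂ δ₀ : ℝ} (hc₁ : 0 < c₁) (hc₂ : 0 < c₂) (hδ₀ : 0 < δ₀)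
    (hlower : ∀ q, L q < θ → c₁ * ‖q - p‖ ^ 2 ≤ L q)
    (hupper : ∀ q, ‖q - p‖ < δ₀ → L q ≤ c₂ * ‖q - p‖ ^ 2) :
    IsGloballyAsymptoticallyStable f p ∧ IsLocallyExponentiallyStable f p := by
  set K := Real.sqrt (c₂ / c₁) with hKdef
  have hK : 0 < K := Real.sqrt_pos.2 (by positivity)
  have hK2 : c₁ * K ^ 2 = c₂ := by
    rw [hKdef, Real.sq_sqrt (by positivity)]; field_simp
  -- Solutions starting in the `δ`-ball start in the sublevel set `{L < θ}`, where the decay is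
  -- exponential from time `0`.
  obtain ⟨δ, hδ, hδδ, hδθ⟩ : ∃ δ > 0, δ ≤ δ₀ ∧ c₂ * δ ^ 2 ≤ θ := by
    refine ⟨min δ₀ (Real.sqrt (θ / c₂)), lt_min hδ₀ (Real.sqrt_pos.2 (by positivity)),
      min_le_left _ _, ?_⟩
    calc c₂ * (min δ₀ (Real.sqrt (θ / c₂))) ^ 2 ≤ c₂ * Real.sqrt (θ / c₂) ^ 2 := by
          gcongr; exact min_le_right _ _
      _ = θ := by rw [Real.sq_sqrt (by positivity)]; field_simp
  have hexp : ∀ x : ℝ → X, IsForwardSolution f x → ‖x 0 - p‖ < δ → ∀ t : ℝ, 0 ≤ t →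
      ‖x t - p‖ ≤ K * Real.exp (-(β / 2) * t) * ‖x 0 - p‖ := by
    intro x hx h0 t ht
    have hup := hupper _ (h0.trans_le hδδ)
    have hlt : L (x 0) < θ := by
      refine hup.trans_lt (lt_of_lt_of_le ?_ hδθ)
      gcongr
    obtain ⟨h1, h2⟩ := hL.le_exp hβ.le hη.le hcont hnonneg hx hlt ht
    have h3 := hlower _ h1
    have h4 : Real.exp (-(β / 2) * t) ^ 2 = Real.exp (-β * t) := by
      rw [← Real.exp_nat_mul]; congr 1; push_cast; ring
    refine le_of_sq_le_sq ?_ (by positivity)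
    refine le_of_mul_le_mul_left ?_ hc₁
    calc c₁ * ‖x t - p‖ ^ 2 ≤ Real.exp (-β * t) * L (x 0) := h3.trans h2
      _ ≤ Real.exp (-β * t) * (c₂ * ‖x 0 - p‖ ^ 2) := by gcongr
      _ = c₁ * (K * Real.exp (-(β / 2) * t) * ‖x 0 - p‖) ^ 2 := by
        rw [mul_pow, mul_pow, h4, ← hK2]; ring
  refine ⟨⟨heq, hcomplete, ?_, ?_⟩, ⟨heq, δ, hδ, K, hK, β / 2, by positivity,
    fun x₀ _ => hcomplete x₀, hexp⟩⟩
  · intro ε hε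
    refine ⟨min δ (ε / K), lt_min hδ (by positivity), fun x hx h0 t ht => ?_⟩
    have h1 := hexp x hx (h0.trans_le (min_le_left _ _)) t ht
    have h2 : ‖x 0 - p‖ < ε / K := h0.trans_le (min_le_right _ _)
    have h3 : Real.exp (-(β / 2) * t) ≤ 1 := by
      rw [Real.exp_le_one_iff]; nlinarith
    calc ‖x t - p‖ ≤ K * Real.exp (-(β / 2) * t) * ‖x 0 - p‖ := h1
      _ ≤ K * 1 * ‖x 0 - p‖ := by gcongr
      _ < K * 1 * (ε / K) := by gcongr
      _ = ε := by field_simp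
  · intro x hx
    obtain ⟨T, hT, hlt⟩ := hL.exists_lt hη hcont hnonneg hx
    have hy := hx.shift hT
    have hbound : ∀ s : ℝ, 0 ≤ s →
        ‖x (T + s) - p‖ ^ 2 ≤ Real.exp (-β * s) * (L (x T) / c₁) := by
      intro s hs
      obtain ⟨h1, h2⟩ := hL.le_exp hβ.le hη.le hcont hnonneg hy (by simpa using hlt) hs
      have h3 := (hlower _ h1).trans h2
      simp only [add_zero] at h3
      rw [mul_div_assoc', le_div_iff₀ hc₁]
      linarith
    have hlim : Tendsto (fun s : ℝ => Real.exp (-β * s) * (L (x T) / c₁)) atTop (𝓝 0) := by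
      have : Tendsto (fun s : ℝ => Real.exp (-β * s)) atTop (𝓝 0) :=
        Real.tendsto_exp_atBot.comp (tendsto_id.const_mul_atTop_of_neg (by linarith))
      simpa using this.mul_const (L (x T) / c₁)
    have hsq : Tendsto (fun s : ℝ => ‖x (T + s) - p‖ ^ 2) atTop (𝓝 0) :=
      squeeze_zero' (Eventually.of_forall fun _ => by positivity)
        ((eventually_ge_atTop 0).mono hbound) hlim
    have hnorm : Tendsto (fun s : ℝ => ‖x (T + s) - p‖) atTop (𝓝 0) := by
      simpa [Real.sqrt_sq (norm_nonneg _)] using hsq.sqrt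
    have hshift : Tendsto (fun s : ℝ => x (T + s)) atTop (𝓝 p) :=
      tendsto_iff_norm_sub_tendsto_zero.2 hnorm
    have h := hshift.comp (tendsto_atTop_add_const_right atTop (-T) tendsto_id)
    simpa [Function.comp_def] using h

end Lyapunov

/-! ### Forward completeness -/

section Existence

variable {X : Type*} [NormedAddCommGroup X] [NormedSpace ℝ X]

/-- On the ball of radius `1 + ‖x₀‖` about `x₀` the field is at most `2K(1 + ‖x₀‖)`, so
Picard–Lindelöf applies up to time `1/(2K)`. This time does not depend on `x₀`, so finitely many
restarts reach any given time. -/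
theorem exists_hasDerivWithinAt_Icc_of_linear_growth [ProperSpace X] {f : X → X}
    (hlip : LocallyLipschitz f) {K : ℝ} (hK : 0 < K) (hgrow : ∀ x, ‖f x‖ ≤ K * (1 + ‖x‖))
    (x₀ : X) : ∃ x : ℝ → X, x 0 = x₀ ∧
      ∀ t ∈ Set.Icc 0 (1 / (2 * K)),
        HasDerivWithinAt x (f (x t)) (Set.Icc 0 (1 / (2 * K))) t := by
  have hτ : 0 ≤ 1 / (2 * K) := by positivity
  obtain ⟨M, hM⟩ := LocallyLipschitzOn.exists_lipschitzOnWith_of_compact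
    (isCompact_closedBall x₀ (1 + ‖x₀‖)) hlip.locallyLipschitzOn
  have hP : IsPicardLindelof (fun _ => f) (tmin := 0) (tmax := 1 / (2 * K))
      ⟨0, le_rfl, hτ⟩ x₀ ⟨1 + ‖x₀‖, by positivity⟩ 0
      ⟨K * (2 * (1 + ‖x₀‖)), by positivity⟩ M := by
    refine IsPicardLindelof.of_time_independent ?_ hM ?_
    · intro x hx
      refine (hgrow x).trans ?_
      have h1 : ‖x‖ ≤ ‖x₀‖ + (1 + ‖x₀‖) := by
        have := norm_le_norm_add_norm_sub' x x₀
        have h2 : ‖x - x₀‖ ≤ 1 + ‖x₀‖ := by rw [← dist_eq_norm]; exact hx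
        linarith
      change K * (1 + ‖x‖) ≤ K * (2 * (1 + ‖x₀‖))
      gcongr
      linarith
    · change K * (2 * (1 + ‖x₀‖)) * max (1 / (2 * K) - 0) (0 - 0) ≤ 1 + ‖x₀‖ - 0
      rw [max_eq_left (by simpa using hτ)]
      apply le_of_eq
      field_simp
      ring
  exact hP.exists_eq_forall_mem_Icc_hasDerivWithinAt₀

/-- A locally Lipschitz vector field of at most linear growth is forward complete. -/
theorem exists_isForwardSolution_of_linear_growth [ProperSpace X] {f : X → X}
    (hlip : LocallyLipschitz f) {K : ℝ} (hK : 0 < K) (hgrow : ∀ x, ‖f x‖ ≤ K * (1 + ‖x‖))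
    (x₀ : X) : ∃ x : ℝ → X, IsForwardSolution f x ∧ x 0 = x₀ := by
  choose φ hφ0 hφ using exists_hasDerivWithinAt_Icc_of_linear_growth hlip hK hgrow
  set τ := 1 / (2 * K) with hτdef
  have hτ : 0 < τ := by positivity
  -- `p n` is the state at time `n τ`, from which the next piece of length `τ` starts.
  let p : ℕ → X := fun n => Nat.rec x₀ (fun _ q => φ q τ) n
  have hp : ∀ n, p (n + 1) = φ (p n) τ := fun n => rfl
  let x : ℝ → X := fun t => φ (p ⌊t / τ⌋₊) (t - ⌊t / τ⌋₊ * τ)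
  have hx : ∀ (n : ℕ) (t : ℝ), n * τ ≤ t → t ≤ (n + 1) * τ → x t = φ (p n) (t - n * τ) := by
    intro n t h1 h2
    rcases h2.lt_or_eq with h | h
    · have : ⌊t / τ⌋₊ = n := by
        have h0 : (0 : ℝ) ≤ t / τ := div_nonneg (le_trans (by positivity) h1) hτ.le
        rw [Nat.floor_eq_iff h0]
        exact ⟨(le_div_iff₀ hτ).2 h1, (div_lt_iff₀ hτ).2 h⟩
      simp only [x, this]
    · have h3 : t / τ = ((n + 1 : ℕ) : ℝ) := by
        rw [h]; push_cast; field_simp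
      have h4 : ⌊t / τ⌋₊ = n + 1 := by rw [h3]; exact Nat.floor_natCast _
      have h5 : t - ((n + 1 : ℕ) : ℝ) * τ = 0 := by rw [h]; push_cast; ring
      have h6 : t - n * τ = τ := by rw [h]; ring
      simp only [x]
      rw [h4, h5, h6, hφ0, hp]
  have hder : ∀ (n : ℕ) (t : ℝ), t ∈ Set.Icc (n * τ) ((n + 1) * τ) →
      HasDerivWithinAt x (f (x t)) (Set.Icc (n * τ) ((n + 1) * τ)) t := by
    intro n t ht
    have hmaps : Set.MapsTo (fun s : ℝ => s - n * τ) (Set.Icc (n * τ) ((n + 1) * τ))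
        (Set.Icc 0 τ) := by
      intro s hs
      exact ⟨by linarith [hs.1], by linarith [hs.2]⟩
    have h1 := (hφ (p n) (t - n * τ) (hmaps ht)).scomp t
      ((hasDerivAt_id t).sub_const (n * τ)).hasDerivWithinAt hmaps
    rw [one_smul, ← hx n t ht.1 ht.2] at h1
    exact h1.congr (fun s hs => hx n s hs.1 hs.2) (hx n t ht.1 ht.2)
  refine ⟨x, ?_, ?_⟩
  · intro t ht
    set n := ⌊t / τ⌋₊ with hn
    have hn1 : n * τ ≤ t := (le_div_iff₀ hτ).1 (Nat.floor_le (by positivity))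
    have hn2 : t < (n + 1) * τ := (div_lt_iff₀ hτ).1 (Nat.lt_floor_add_one _)
    rcases hn1.lt_or_eq with h | h
    · exact ((hder n t ⟨hn1, hn2.le⟩).hasDerivAt (Icc_mem_nhds h hn2)).hasDerivWithinAt
    -- At a grid point the two adjacent pieces supply the left and right derivatives; both equal `f
    -- (x t)`. At `t = 0` only the right one is needed.
    · have hright : HasDerivWithinAt x (f (x t)) (Set.Ici t) t :=
        (hder n t ⟨hn1, hn2.le⟩).mono_of_mem_nhdsWithin
          (by rw [h]; exact Icc_mem_nhdsGE (by rwa [← h] at hn2 ⊢))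
      rcases Nat.eq_zero_or_pos n with h0 | h0
      · have : t = 0 := by rw [← h, h0]; simp
        rwa [this] at hright ⊢
      · obtain ⟨m, hm⟩ := Nat.exists_eq_add_of_lt h0
        rw [zero_add] at hm
        have ht' : t = ((m : ℝ) + 1) * τ := by rw [← h, hm]; push_cast; ring
        have hmt : m * τ < t := by rw [ht']; linarith
        have hleft : HasDerivWithinAt x (f (x t)) (Set.Iic t) t :=
          (hder m t ⟨hmt.le, ht'.le⟩).mono_of_mem_nhdsWithin
            (by rw [← ht']; exact Icc_mem_nhdsLE hmt)
        have := hleft.union hright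
        rw [Set.Iic_union_Ici] at this
        exact this.mono (Set.subset_univ _)
  · have h0 : p 0 = x₀ := rfl
    rw [hx 0 0 (by simp) (by simpa using hτ.le), h0]
    simpa using hφ0 x₀

end Existence

/-! ### One-sided calculus of the saturation -/

section Saturation

/-- If the values at `t` differ, or agree with different right derivatives, one function dominates
just after `t`. If both agree, the two functions share one first-order expansion and so does their
maximum. -/
theorem HasDerivWithinAt.exists_max {f g : ℝ → ℝ} {f' g' t : ℝ}
    (hf : HasDerivWithinAt f f' (Set.Ici t) t) (hg : HasDerivWithinAt g g' (Set.Ici t) t) :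
    ∃ D, HasDerivWithinAt (fun s => max (f s) (g s)) D (Set.Ici t) t ∧
      ((D = f' ∧ max (f t) (g t) = f t) ∨ (D = g' ∧ max (f t) (g t) = g t)) := by
  have key : ∀ {f g : ℝ → ℝ} {f' : ℝ}, HasDerivWithinAt f f' (Set.Ici t) t →
      (∀ᶠ s in 𝓝[Set.Ioi t] t, g s ≤ f s) → g t ≤ f t →
      HasDerivWithinAt (fun s => max (f s) (g s)) f' (Set.Ici t) t := by
    intro f g f' hf hev hle
    refine (hasDerivWithinAt_Ioi_iff_Ici.1 ?_)
    refine (hasDerivWithinAt_Ioi_iff_Ici.2 hf).congr_of_eventuallyEq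
      (hev.mono fun s hs => max_eq_left hs) (max_eq_left hle)
  have key2 : ∀ {f g : ℝ → ℝ} {f' g' : ℝ}, HasDerivWithinAt f f' (Set.Ici t) t →
      HasDerivWithinAt g g' (Set.Ici t) t → (g t < f t ∨ (g t = f t ∧ g' < f')) →
      ∀ᶠ s in 𝓝[Set.Ioi t] t, g s ≤ f s := by
    intro f g f' g' hf hg h
    rcases h with h | ⟨h1, h2⟩
    · have := (hg.continuousWithinAt.eventually_lt hf.continuousWithinAt h)
      exact (this.filter_mono (nhdsWithin_mono _ Set.Ioi_subset_Ici_self)).mono fun s hs => hs.le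
    · have hd := (hasDerivWithinAt_Ioi_iff_Ici.2 (hf.sub hg))
      rw [hasDerivWithinAt_iff_tendsto_slope' (by simp)] at hd
      have hpos := hd.eventually (lt_mem_nhds (sub_pos.2 h2))
      filter_upwards [hpos, self_mem_nhdsWithin] with s hs hst
      have hst' : 0 < s - t := sub_pos.2 hst
      rw [slope_def_field, div_pos_iff_of_pos_right hst'] at hs
      simp only [Pi.sub_apply] at hs
      linarith
  rcases lt_trichotomy (f t) (g t) with h | h | h
  · refine ⟨g', ?_, Or.inr ⟨rfl, max_eq_right h.le⟩⟩
    have := key hg (key2 hg hf (Or.inl h)) h.le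
    simpa only [max_comm] using this
  · rcases lt_trichotomy f' g' with h' | h' | h'
    · refine ⟨g', ?_, Or.inr ⟨rfl, max_eq_right h.le⟩⟩
      have := key hg (key2 hg hf (Or.inr ⟨h, h'⟩)) h.le
      simpa only [max_comm] using this
    · refine ⟨f', ?_, Or.inl ⟨rfl, max_eq_left h.ge⟩⟩
      subst h'
      rw [hasDerivWithinAt_iff_isLittleO] at hf hg ⊢
      rw [Asymptotics.isLittleO_iff] at hf hg ⊢
      intro c hc
      filter_upwards [hf hc, hg hc] with s h1 h2
      rw [← h, max_self] at *
      rcases max_choice (f s) (g s) with h3 | h3 <;> rw [h3] <;> assumption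
    · refine ⟨f', ?_, Or.inl ⟨rfl, max_eq_left h.ge⟩⟩
      exact key hf (key2 hf hg (Or.inr ⟨h.symm, h'⟩)) h.ge
  · exact ⟨f', key hf (key2 hf hg (Or.inl h)) h.le, Or.inl ⟨rfl, max_eq_left h.le⟩⟩

/-- Even at a corner of `sat`, a right derivative other than `0` can occur only where `sat` acts as
the identity; `HasDerivWithinAt.satEnergy` needs exactly this alternative. -/
theorem HasDerivWithinAt.exists_sat {w : ℝ → ℝ} {w' t : ℝ} (lo hi : ℝ)
    (hw : HasDerivWithinAt w w' (Set.Ici t) t) :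
    ∃ D, HasDerivWithinAt (fun s => sat lo hi (w s)) D (Set.Ici t) t ∧
      (D = 0 ∨ (D = w' ∧ sat lo hi (w t) = w t)) := by
  obtain ⟨D₁, h1, h2⟩ := hw.neg.exists_max (hasDerivWithinAt_const t (Set.Ici t) (-hi))
  have h1' : HasDerivWithinAt (fun s => min (w s) hi) (-D₁) (Set.Ici t) t := by
    have := h1.neg
    refine this.congr_of_eventuallyEq (Eventually.of_forall fun s => ?_) ?_ <;>
    simp [max_neg_neg]
  obtain ⟨D, h3, h4⟩ := (hasDerivWithinAt_const t (Set.Ici t) lo).exists_max h1'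
  refine ⟨D, h3, ?_⟩
  have hmm : max (-w t) (-hi) = - min (w t) hi := max_neg_neg _ _
  rcases h4 with ⟨h4, _⟩ | ⟨h4, h5⟩
  · exact Or.inl h4
  · rcases h2 with ⟨h2, h6⟩ | ⟨h2, h6⟩
    · refine Or.inr ⟨by rw [h4, h2, neg_neg], ?_⟩
      simp only [Pi.neg_apply] at h6
      rw [sat, h5]
      linarith
    · exact Or.inl (by rw [h4, h2, neg_zero])

theorem sat_mem_Icc {lo hi : ℝ} (h : lo ≤ hi) (s : ℝ) : sat lo hi s ∈ Set.Icc lo hi :=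
  ⟨le_max_left _ _, max_le h (min_le_right _ _)⟩

theorem sat_of_mem_Icc {lo hi s : ℝ} (h : s ∈ Set.Icc lo hi) : sat lo hi s = s := by
  rw [sat, min_eq_left h.2, max_eq_right h.1]

theorem sat_cases {lo hi : ℝ} (h : lo ≤ hi) (s : ℝ) :
    (s ≤ lo ∧ sat lo hi s = lo) ∨ (hi ≤ s ∧ sat lo hi s = hi) ∨
      (lo ≤ s ∧ s ≤ hi ∧ sat lo hi s = s) := by
  rcases le_total s lo with h1 | h1
  · exact Or.inl ⟨h1, by rw [sat, min_eq_left (h1.trans h), max_eq_left h1]⟩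
  · rcases le_total hi s with h2 | h2
    · exact Or.inr (Or.inl ⟨h2, by rw [sat, min_eq_right h2, max_eq_right h]⟩)
    · exact Or.inr (Or.inr ⟨h1, h2, sat_of_mem_Icc ⟨h1, h2⟩⟩)

theorem locallyLipschitz_sat (lo hi : ℝ) : LocallyLipschitz (sat lo hi) :=
  (LocallyLipschitz.const lo).max (LocallyLipschitz.id.min (LocallyLipschitz.const hi))

theorem continuous_sat (lo hi : ℝ) : Continuous (sat lo hi) :=
  (locallyLipschitz_sat lo hi).continuous

end Saturation

/-! ### The composite Lyapunov function of the slow loop -/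

section SlowIntegralControl

/-- `∫ (sat s - uss) ds` from `uss` to `w`, for `uss` in the range of `sat`. -/
noncomputable def satEnergy (lo hi uss w : ℝ) : ℝ :=
  (sat lo hi w - uss) ^ 2 / 2 + (w - sat lo hi w) * (sat lo hi w - uss)

section

variable {lo hi uss ρ : ℝ}

/-- The product `(w - sat w)(sat w - uss)` is nonnegative: under saturation both factors point away
from `uss`, otherwise the first is zero. -/
theorem half_sq_le_satEnergy (hlo : lo ≤ uss) (hhi : uss ≤ hi) (w : ℝ) :
    (sat lo hi w - uss) ^ 2 / 2 ≤ satEnergy lo hi uss w := by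
  unfold satEnergy
  rcases sat_cases (hlo.trans hhi) w with ⟨h1, h2⟩ | ⟨h1, h2⟩ | ⟨_, _, h2⟩ <;> rw [h2] <;> nlinarith

theorem sat_eq_self_of_satEnergy_lt (hρ : 0 < ρ) (hlo : lo + ρ ≤ uss) (hhi : uss + ρ ≤ hi) {w : ℝ}
    (hw : satEnergy lo hi uss w < ρ ^ 2 / 2) : sat lo hi w = w := by
  have h := half_sq_le_satEnergy (w := w) (by linarith : lo ≤ uss) (by linarith : uss ≤ hi)
  rcases sat_cases (by linarith : lo ≤ hi) w with ⟨h1, h2⟩ | ⟨h1, h2⟩ | ⟨_, _, h2⟩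
  · rw [h2] at h; nlinarith
  · rw [h2] at h; nlinarith
  · exact h2

/-- A saturated input is at distance at least `ρ` from `uss`; for an unsaturated one the energy is
half the square. This bounds the dissipation below away from the equilibrium. -/
theorem le_sq_of_le_satEnergy (hρ : 0 < ρ) (hlo : lo + ρ ≤ uss) (hhi : uss + ρ ≤ hi) {w : ℝ}
    (hw : ρ ^ 2 / 4 ≤ satEnergy lo hi uss w) : ρ ^ 2 / 2 ≤ (sat lo hi w - uss) ^ 2 := by
  unfold satEnergy at hw
  rcases sat_cases (by linarith : lo ≤ hi) w with ⟨h1, h2⟩ | ⟨h1, h2⟩ | ⟨_, _, h2⟩ <;>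
    rw [h2] at hw ⊢ <;> nlinarith

theorem sat_eq_self_of_abs_lt (hlo : lo + ρ ≤ uss) (hhi : uss + ρ ≤ hi) {w : ℝ}
    (hw : |w - uss| < ρ) : sat lo hi w = w := by
  rw [abs_lt] at hw
  exact sat_of_mem_Icc ⟨by linarith, by linarith⟩

theorem satEnergy_of_sat_eq {w : ℝ} (hw : sat lo hi w = w) :
    satEnergy lo hi uss w = (sat lo hi w - uss) ^ 2 / 2 := by
  rw [satEnergy, hw]; ring

theorem continuous_satEnergy : Continuous (satEnergy lo hi uss) := by
  have := continuous_sat lo hi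
  unfold satEnergy
  fun_prop

/-- The product rule leaves the extra term `(w - sat w) u'`, which vanishes under either alternative
of `h`. -/
theorem HasDerivWithinAt.satEnergy {w : ℝ → ℝ} {w' u' t : ℝ} {s : Set ℝ}
    (hw : HasDerivWithinAt w w' s t) (hu : HasDerivWithinAt (fun τ => sat lo hi (w τ)) u' s t)
    (h : u' = 0 ∨ (u' = w' ∧ sat lo hi (w t) = w t)) :
    HasDerivWithinAt (fun τ => satEnergy lo hi uss (w τ)) (w' * (sat lo hi (w t) - uss)) s t := by
  have h1 := (((hu.sub_const uss).pow 2).div_const 2).add ((hw.sub hu).mul (hu.sub_const uss))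
  refine h1.congr_deriv ?_
  rcases h with h | ⟨h, h2⟩
  · rw [h]; simp
  · simp only [Pi.sub_apply, h, h2]
    norm_num
    ring

end

variable {V : Type*} [NormedAddCommGroup V] [NormedSpace ℝ V]

set_option maxHeartbeats 1000000 in
/-- Stability of a slow integral loop around a plant `ẋ = G u x` whose frozen-input equilibria
`π u` are exponentially stable with the common quadratic Lyapunov function `Q`, and whose
steady-state output `c (π u)` is strictly monotone at `uss`. -/
theorem exists_gain_stable_slow_integral_control {lo hi uss : ℝ} (huss : uss ∈ Set.Ioo lo hi)
    (Q : V →L[ℝ] V →L[ℝ] ℝ) (hsymm : ∀ x y, Q x y = Q y x) {q : ℝ} (hq : 0 < q)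
    (hQ : ∀ x, q * ‖x‖ ^ 2 ≤ Q x x) (G : ℝ → V → V) (π π' : ℝ → V) (c : V →L[ℝ] ℝ)
    {ε : ℝ} (hε : 0 < ε)
    (hG : ∀ u ∈ Set.Icc lo hi, ∀ x, Q (x - π u) (G u x) ≤ -ε * ‖x - π u‖ ^ 2)
    (hG0 : G uss (π uss) = 0)
    (hπ : ∀ u ∈ Set.Icc lo hi, HasDerivWithinAt π (π' u) (Set.Icc lo hi) u)
    {M : ℝ} (hM : ∀ u ∈ Set.Icc lo hi, ‖π' u‖ ≤ M)
    {σ : ℝ} (hσ : |σ| = 1) {γ : ℝ} (hγ : 0 < γ)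
    (hmono : ∀ u ∈ Set.Icc lo hi,
      σ * (u - uss) * (c (π u) - c (π uss)) ≤ -γ * (u - uss) ^ 2) :
    ∃ kstar : ℝ, 0 < kstar ∧ ∀ k ∈ Set.Ioo 0 kstar, ∀ f : V × ℝ → V × ℝ,
      (∀ p, f p = (G (sat lo hi (uss + σ * k * p.2)) p.1, c p.1 - c (π uss))) →
      (∀ x₀, ∃ x : ℝ → V × ℝ, IsForwardSolution f x ∧ x 0 = x₀) →
      IsGloballyAsymptoticallyStable f (π uss, 0) ∧
      IsLocallyExponentiallyStable f (π uss, 0) := by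
  have huss' : uss ∈ Set.Icc lo hi := ⟨huss.1.le, huss.2.le⟩
  have hlohi : lo ≤ hi := huss'.1.trans huss'.2
  have hM0 : 0 ≤ M := (norm_nonneg _).trans (hM uss huss')
  obtain ⟨P, hP⟩ : ∃ P, P = ‖Q‖ := ⟨_, rfl⟩
  obtain ⟨m, hm⟩ : ∃ m, m = ‖c‖ := ⟨_, rfl⟩
  have hP0 : 0 ≤ P := by rw [hP]; positivity
  have hm0 : 0 ≤ m := by rw [hm]; positivity
  have hQle : ∀ x y, Q x y ≤ P * ‖x‖ * ‖y‖ := fun x y =>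
    hP ▸ (le_abs_self _).trans (Q.le_opNorm₂ x y)
  have hcle : ∀ x, |c x| ≤ m * ‖x‖ := fun x => hm ▸ c.le_opNorm x
  have hQ0 : ∀ x, 0 ≤ Q x x := fun x => le_trans (by positivity) (hQ x)
  have hπlip : ∀ u ∈ Set.Icc lo hi, ‖π u - π uss‖ ≤ M * |u - uss| := fun u hu =>
    (convex_Icc lo hi).norm_image_sub_le_of_norm_hasDerivWithin_le hπ hM huss' hu
  obtain ⟨ρ, hρ, hlo, hhi⟩ : ∃ ρ, 0 < ρ ∧ lo + ρ ≤ uss ∧ uss + ρ ≤ hi :=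
    ⟨min (uss - lo) (hi - uss), lt_min (sub_pos.2 huss.1) (sub_pos.2 huss.2),
      by linarith [min_le_left (uss - lo) (hi - uss)],
      by linarith [min_le_right (uss - lo) (hi - uss)]⟩
  -- `k a` bounds the coefficient of the cross term `‖y‖ |u - uss|`, from the drift of `π(u)` and
  -- from the integrator. `T` adds the drift's `‖y‖²` coefficient to the Young remainder of the
  -- cross term; the `1` keeps `T` positive.
  obtain ⟨a, ha⟩ : ∃ a, a = 2 * P * M * (m * M) + m := ⟨_, rfl⟩
  obtain ⟨T, hT⟩ : ∃ T, T = 2 * P * M * m + a ^ 2 / (2 * γ) + 1 := ⟨_, rfl⟩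
  have hTpos : 0 < T := by rw [hT]; positivity
  refine ⟨ε / T, by positivity, ?_⟩
  rintro k ⟨hk0, hk⟩ f hf hcomplete
  have hkT : k * T ≤ ε := by rw [lt_div_iff₀ hTpos] at hk; exact hk.le
  have hσ2 : σ ^ 2 = 1 := by rw [← sq_abs, hσ]; norm_num
  -- the dissipation inequality, in terms of the sizes of the two errors
  have hdiss : ∀ Y d : ℝ, 0 ≤ d →
      -2 * ε * Y ^ 2 + 2 * (P * Y * (M * (k * (m * (Y + M * d))))) +
        (k * (m * Y * d) - k * γ * d ^ 2) ≤ -ε * Y ^ 2 - k * γ / 2 * d ^ 2 := by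
    intro Y d hd
    have h1 : a * Y * d ≤ γ / 2 * d ^ 2 + a ^ 2 / (2 * γ) * Y ^ 2 := by
      have : γ / 2 * d ^ 2 + a ^ 2 / (2 * γ) * Y ^ 2 - a * Y * d
          = (γ * d - a * Y) ^ 2 / (2 * γ) := by field_simp; ring
      have h2 : 0 ≤ (γ * d - a * Y) ^ 2 / (2 * γ) := by positivity
      linarith
    have h2 : k * (a * Y * d) ≤ k * (γ / 2 * d ^ 2 + a ^ 2 / (2 * γ) * Y ^ 2) := by gcongr
    have h3 : k * T * Y ^ 2 ≤ ε * Y ^ 2 := by gcongr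
    have h4 : 0 ≤ k * Y ^ 2 := by positivity
    rw [hT] at h3
    rw [ha] at h2
    rw [ha] at h3
    linarith
  obtain ⟨u, hu⟩ : ∃ u : ℝ → ℝ, u = fun z => sat lo hi (uss + σ * k * z) := ⟨_, rfl⟩
  have huz : ∀ z, u z = sat lo hi (uss + σ * k * z) := fun z => by rw [hu]
  have humem : ∀ z, u z ∈ Set.Icc lo hi := fun z => huz z ▸ sat_mem_Icc hlohi _
  have hucont : Continuous u := by
    rw [hu]
    exact (continuous_sat lo hi).comp (by fun_prop)
  let L : V × ℝ → ℝ := fun p =>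
    Q (p.1 - π (u p.2)) (p.1 - π (u p.2)) + satEnergy lo hi uss (uss + σ * k * p.2)
  have hE0 : ∀ w, (sat lo hi w - uss) ^ 2 / 2 ≤ satEnergy lo hi uss w :=
    half_sq_le_satEnergy huss'.1 huss'.2
  have hnonneg : ∀ p, 0 ≤ L p := fun p =>
    add_nonneg (hQ0 _) (le_trans (by positivity) (hE0 _))
  have hcont : Continuous L := by
    have hπcont : ContinuousOn π (Set.Icc lo hi) := fun v hv => (hπ v hv).continuousWithinAt
    have h1 : Continuous fun p : V × ℝ => π (u p.2) :=
      hπcont.comp_continuous (hucont.comp continuous_snd) fun p => humem _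
    have h2 : Continuous fun p : V × ℝ => satEnergy lo hi uss (uss + σ * k * p.2) :=
      continuous_satEnergy.comp (by fun_prop)
    exact Continuous.add ((Q.continuous.comp (continuous_fst.sub h1)).clm_apply
      (continuous_fst.sub h1)) h2
  have hsmall : ∀ p, L p < ρ ^ 2 / 2 → u p.2 = uss + σ * k * p.2 := fun p hp =>
    (huz _).trans (sat_eq_self_of_satEnergy_lt hρ hlo hhi (by
      have := hQ0 (p.1 - π (u p.2))
      simp only [L] at hp
      linarith))
  have hLeq : ∀ p, u p.2 = uss + σ * k * p.2 →
      L p = Q (p.1 - π (u p.2)) (p.1 - π (u p.2)) + (u p.2 - uss) ^ 2 / 2 := by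
    intro p hp
    have : sat lo hi (uss + σ * k * p.2) = uss + σ * k * p.2 := (huz _).symm.trans hp
    simp only [L]
    rw [satEnergy_of_sat_eq this, huz]
  have hsq : ∀ p : V × ℝ, u p.2 = uss + σ * k * p.2 → (u p.2 - uss) ^ 2 = k ^ 2 * p.2 ^ 2 := by
    intro p hp
    rw [hp, add_sub_cancel_left, mul_pow, mul_pow, hσ2, one_mul]
  -- Both constants compare the dissipation `ε‖y‖² + (kγ/2)(u - uss)²` with `L`. For `η`: if `L ≥
  -- ρ²/2`, one of its two summands is at least `ρ²/4`. `P + 1` replaces `P`, which may be zero.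
  obtain ⟨β, hβ⟩ : ∃ β, β = min (ε / (P + 1)) (k * γ) := ⟨_, rfl⟩
  obtain ⟨η, hη⟩ : ∃ η, η = min (ε * (ρ ^ 2 / 4 / (P + 1))) (k * γ / 2 * (ρ ^ 2 / 2)) := ⟨_, rfl⟩
  have hβ0 : 0 < β := hβ ▸ lt_min (by positivity) (by positivity)
  have hη0 : 0 < η := hη ▸ lt_min (by positivity) (by positivity)
  have hdec : DecreasesAlongSolutions f L (ρ ^ 2 / 2) β η := by
    intro x hx t ht
    have hxt := (hx t ht).mono (Set.Ici_subset_Ici.2 ht)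
    rw [hf] at hxt
    have hx1 : HasDerivWithinAt (fun s => (x s).1) (G (u (x t).2) (x t).1) (Set.Ici t) t := by
      rw [huz]
      exact (ContinuousLinearMap.fst ℝ V ℝ).hasFDerivAt.comp_hasDerivWithinAt t hxt
    have hx2 : HasDerivWithinAt (fun s => (x s).2) (c (x t).1 - c (π uss)) (Set.Ici t) t :=
      (ContinuousLinearMap.snd ℝ V ℝ).hasFDerivAt.comp_hasDerivWithinAt t hxt
    obtain ⟨w', hw'⟩ : ∃ w', w' = σ * k * (c (x t).1 - c (π uss)) := ⟨_, rfl⟩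
    have hw : HasDerivWithinAt (fun s => uss + σ * k * (x s).2) w' (Set.Ici t) t :=
      hw' ▸ (hx2.const_mul (σ * k)).const_add uss
    obtain ⟨u', hu', hu'w⟩ := hw.exists_sat lo hi
    have hE := hw.satEnergy (uss := uss) hu' hu'w
    rw [← huz] at hE
    have hu'2 : HasDerivWithinAt (fun s => u (x s).2) u' (Set.Ici t) t := by
      simpa only [huz] using hu'
    have hπt : HasDerivWithinAt (fun s => π (u (x s).2)) (u' • π' (u (x t).2)) (Set.Ici t) t :=
      HasDerivWithinAt.scomp (h := fun s => u (x s).2) t (hπ _ (humem _)) hu'2 fun s _ => humem _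
    have hy := hx1.sub hπt
    have hV := Q.hasDerivWithinAt_of_bilinear hy hy
    refine ⟨_, hV.add hE, ?_⟩
    have hbound : Q (((fun s => (x s).1) - fun s => π (u (x s).2)) t)
          (G (u (x t).2) (x t).1 - u' • π' (u (x t).2)) +
        Q (G (u (x t).2) (x t).1 - u' • π' (u (x t).2))
          (((fun s => (x s).1) - fun s => π (u (x s).2)) t) + w' * (u (x t).2 - uss) ≤
        -ε * ‖(x t).1 - π (u (x t).2)‖ ^ 2 - k * γ / 2 * |u (x t).2 - uss| ^ 2 := by
      simp only [Pi.sub_apply]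
      rw [hsymm (G _ _ - _)]
      set v := u (x t).2 with hv
      have hvm : v ∈ Set.Icc lo hi := humem _
      set y := (x t).1 - π v with hydef
      have hxy : c (x t).1 - c (π uss) = c y + (c (π v) - c (π uss)) := by
        rw [hydef, map_sub]; ring
      have h1 : Q y (G v (x t).1) ≤ -ε * ‖y‖ ^ 2 := hG v hvm _
      have hcy : |c (x t).1 - c (π uss)| ≤ m * (‖y‖ + M * |v - uss|) := by
        have h2 : (x t).1 - π uss = y + (π v - π uss) := by rw [hydef]; abel
        rw [← map_sub, h2]
        refine (hcle _).trans ?_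
        gcongr
        exact (norm_add_le _ _).trans (by gcongr; exact hπlip v hvm)
      have hw'le : |w'| ≤ k * (m * (‖y‖ + M * |v - uss|)) := by
        rw [hw', abs_mul, abs_mul, hσ, one_mul, abs_of_pos hk0]
        gcongr
      have hu'le : |u'| ≤ |w'| := by
        rcases hu'w with h | ⟨h, _⟩
        · rw [h, abs_zero]; positivity
        · rw [h]
      have h3 : Q y (-(u' • π' v)) ≤ P * ‖y‖ * (M * (k * (m * (‖y‖ + M * |v - uss|)))) := by
        refine (hQle _ _).trans ?_
        rw [norm_neg, norm_smul, mul_comm M]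
        gcongr
        · exact hu'le.trans hw'le
        · exact hM v hvm
      have h4 : w' * (v - uss) ≤ k * (m * ‖y‖ * |v - uss|) - k * γ * |v - uss| ^ 2 := by
        have h5 : σ * (c y) * (v - uss) ≤ m * ‖y‖ * |v - uss| := by
          refine (le_abs_self _).trans ?_
          rw [abs_mul, abs_mul, hσ, one_mul]
          gcongr
          exact hcle y
        have h6 := hmono v hvm
        have h7 : w' * (v - uss) = k * (σ * c y * (v - uss) +
            σ * (v - uss) * (c (π v) - c (π uss))) := by
          rw [hw', hxy]; ring
        rw [h7, sq_abs]
        have := mul_le_mul_of_nonneg_left (add_le_add h5 h6) hk0.le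
        linarith
      have h8 := hdiss ‖y‖ |v - uss| (abs_nonneg _)
      rw [sub_eq_add_neg (G v (x t).1), map_add]
      linarith
    rw [sq_abs] at hbound
    have hQy := hQle ((x t).1 - π (u (x t).2)) ((x t).1 - π (u (x t).2))
    set Y := ‖(x t).1 - π (u (x t).2)‖ with hY
    set d := u (x t).2 - uss with hd
    constructor
    · intro hlt
      refine hbound.trans ?_
      rw [hLeq _ (hsmall _ hlt)]
      have hβ1 : β * (P + 1) ≤ ε := (le_div_iff₀ (by positivity)).1 (hβ ▸ min_le_left _ _)
      have hβ2 : β ≤ k * γ := hβ ▸ min_le_right _ _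
      have h1 : β * (P + 1) * Y ^ 2 ≤ ε * Y ^ 2 := by gcongr
      have h2 : β * (d ^ 2 / 2) ≤ k * γ * (d ^ 2 / 2) := by gcongr
      have h3 : β * Q ((x t).1 - π (u (x t).2)) ((x t).1 - π (u (x t).2)) ≤ β * (P * Y * Y) := by
        gcongr
      have h4 : 0 ≤ β * Y ^ 2 := by positivity
      linarith
    · intro hge
      refine hbound.trans ?_
      simp only [L] at hge
      rcases le_or_gt (ρ ^ 2 / 4) (Q ((x t).1 - π (u (x t).2)) ((x t).1 - π (u (x t).2)))
        with h | h
      · have h1 : ρ ^ 2 / 4 / (P + 1) ≤ Y ^ 2 := by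
          rw [div_le_iff₀ (by positivity)]
          nlinarith [sq_nonneg Y]
        have h2 : ε * (ρ ^ 2 / 4 / (P + 1)) ≤ ε * Y ^ 2 := by gcongr
        have h3 : η ≤ ε * (ρ ^ 2 / 4 / (P + 1)) := hη ▸ min_le_left _ _
        have h4 : 0 ≤ k * γ / 2 * d ^ 2 := by positivity
        linarith
      · have h1 := le_sq_of_le_satEnergy hρ hlo hhi (w := uss + σ * k * (x t).2) (by linarith)
        rw [← huz, ← hd] at h1
        have h2 : k * γ / 2 * (ρ ^ 2 / 2) ≤ k * γ / 2 * d ^ 2 := by gcongr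
        have h3 : η ≤ k * γ / 2 * (ρ ^ 2 / 2) := hη ▸ min_le_right _ _
        have h4 : 0 ≤ ε * Y ^ 2 := by positivity
        linarith
  have hnorm : ∀ p : V × ℝ, ‖p - (π uss, 0)‖ = max ‖p.1 - π uss‖ |p.2| := by
    intro p
    rw [Prod.norm_def]
    simp
  -- Without saturation `z² = (u - uss)² / k²`, and `‖x - π uss‖² ≤ 2‖y‖² + 2M²(u - uss)²`; `N`
  -- dominates both coefficients. The radius `ρ / k` below keeps `|k z| < ρ`, so `sat` is inactive
  -- there.
  obtain ⟨N, hN⟩ : ∃ N, N = 2 * M ^ 2 + 1 / k ^ 2 := ⟨_, rfl⟩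
  have hN0 : 0 < N := by rw [hN]; positivity
  refine hdec.stability (c₁ := min (q / 2) (1 / (2 * N))) (c₂ := P * (1 + M * k) ^ 2 + k ^ 2 / 2)
    (δ₀ := ρ / k) hβ0 hη0 (by positivity) hcont hnonneg ?_ hcomplete
    (lt_min (by positivity) (by positivity)) (by positivity) (by positivity) ?_ ?_
  · rw [hf]
    have : sat lo hi (uss + σ * k * 0) = uss := by
      rw [mul_zero, add_zero]; exact sat_of_mem_Icc huss'
    simp only [this, hG0, sub_self]
    rfl
  · intro p hp
    have hw := hsmall p hp
    rw [hLeq p hw, hnorm]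
    have hQy := hQ (p.1 - π (u p.2))
    have h1 : ‖p.1 - π uss‖ ≤ ‖p.1 - π (u p.2)‖ + M * |u p.2 - uss| := by
      have : p.1 - π uss = (p.1 - π (u p.2)) + (π (u p.2) - π uss) := by abel
      rw [this]
      exact (norm_add_le _ _).trans (by gcongr; exact hπlip _ (humem _))
    have h2 := hsq p hw
    set Y := ‖p.1 - π (u p.2)‖
    have h3 : (max ‖p.1 - π uss‖ |p.2|) ^ 2 ≤ 2 * Y ^ 2 + N * (u p.2 - uss) ^ 2 := by
      have h4 : ‖p.1 - π uss‖ ^ 2 ≤ 2 * Y ^ 2 + 2 * M ^ 2 * (u p.2 - uss) ^ 2 := by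
        have h5 : ‖p.1 - π uss‖ ^ 2 ≤ (Y + M * |u p.2 - uss|) ^ 2 := by gcongr
        have h6 := sq_nonneg (Y - M * |u p.2 - uss|)
        have h7 := sq_abs (u p.2 - uss)
        rw [← h7]
        linarith
      have h5 : |p.2| ^ 2 = 1 / k ^ 2 * (u p.2 - uss) ^ 2 := by
        rw [h2, sq_abs]; field_simp
      have h8 : 0 ≤ 1 / k ^ 2 * (u p.2 - uss) ^ 2 := by positivity
      have h9 : 0 ≤ 2 * M ^ 2 * (u p.2 - uss) ^ 2 := by positivity
      have h10 : 0 ≤ 2 * Y ^ 2 := by positivity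
      rw [hN, add_mul]
      rcases max_choice ‖p.1 - π uss‖ |p.2| with h | h <;> rw [h] <;> linarith
    have hc1 : min (q / 2) (1 / (2 * N)) ≤ q / 2 := min_le_left _ _
    have hc2 : min (q / 2) (1 / (2 * N)) ≤ 1 / (2 * N) := min_le_right _ _
    have hc0 : 0 ≤ min (q / 2) (1 / (2 * N)) := le_min (by positivity) (by positivity)
    calc _ ≤ min (q / 2) (1 / (2 * N)) * (2 * Y ^ 2 + N * (u p.2 - uss) ^ 2) := by gcongr
      _ = min (q / 2) (1 / (2 * N)) * (2 * Y ^ 2) +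
          min (q / 2) (1 / (2 * N)) * (N * (u p.2 - uss) ^ 2) := by ring
      _ ≤ q / 2 * (2 * Y ^ 2) + 1 / (2 * N) * (N * (u p.2 - uss) ^ 2) := by gcongr
      _ = q * Y ^ 2 + (u p.2 - uss) ^ 2 / 2 := by field_simp
      _ ≤ _ := by gcongr
  · intro p hp
    rw [hnorm] at hp ⊢
    have hz : |p.2| < ρ / k := (le_max_right _ _).trans_lt hp
    have hw : u p.2 = uss + σ * k * p.2 := by
      rw [huz]
      refine sat_eq_self_of_abs_lt hlo hhi ?_
      rw [add_sub_cancel_left, abs_mul, abs_mul, hσ, one_mul, abs_of_pos hk0, mul_comm]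
      exact (lt_div_iff₀ hk0).1 hz
    rw [hLeq p hw, hsq p hw]
    have hd : |u p.2 - uss| = k * |p.2| := by
      rw [hw, add_sub_cancel_left, abs_mul, abs_mul, hσ, one_mul, abs_of_pos hk0]
    have hQy := hQle (p.1 - π (u p.2)) (p.1 - π (u p.2))
    have h1 : ‖p.1 - π (u p.2)‖ ≤ ‖p.1 - π uss‖ + M * |u p.2 - uss| := by
      have : p.1 - π (u p.2) = (p.1 - π uss) - (π (u p.2) - π uss) := by abel
      rw [this]
      exact (norm_sub_le _ _).trans (by gcongr; exact hπlip _ (humem _))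
    set R := max ‖p.1 - π uss‖ |p.2|
    have h2 : ‖p.1 - π (u p.2)‖ ≤ (1 + M * k) * R := by
      rw [hd] at h1
      have h3 : ‖p.1 - π uss‖ ≤ R := le_max_left _ _
      have h4 : M * (k * |p.2|) ≤ M * (k * R) := by gcongr; exact le_max_right _ _
      linarith
    calc _ ≤ P * ‖p.1 - π (u p.2)‖ * ‖p.1 - π (u p.2)‖ + k ^ 2 * |p.2| ^ 2 / 2 := by
          rw [sq_abs]; gcongr
      _ ≤ P * ((1 + M * k) * R) * ((1 + M * k) * R) + k ^ 2 * R ^ 2 / 2 := by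
          have h3 : |p.2| ≤ R := le_max_right _ _
          gcongr
      _ = _ := by ring

end SlowIntegralControl

/-! ### Regularity and growth of the closed-loop field -/

section SaturatedLoop

variable {V : Type*} [NormedAddCommGroup V] [NormedSpace ℝ V]

theorem locallyLipschitz_saturatedLoop (A B : V →L[ℝ] V) (b E : V) (c : V →L[ℝ] ℝ)
    (lo hi α κ r : ℝ) : LocallyLipschitz fun p : V × ℝ =>
      (A p.1 + sat lo hi (α + κ * p.2) • (B p.1 + b) + E, c p.1 - r) := by
  have h1 : LocallyLipschitz fun z : ℝ => α + κ * z :=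
    ContDiff.locallyLipschitz (𝕂 := ℝ) (by fun_prop)
  have h2 : LocallyLipschitz fun p : V × ℝ => p.2 := LipschitzWith.prod_snd.locallyLipschitz
  -- The field factors as a smooth map after this one, which isolates the nonsmooth `sat`.
  have h3 : LocallyLipschitz fun p : V × ℝ => (p, sat lo hi (α + κ * p.2)) :=
    LocallyLipschitz.id.prodMk ((locallyLipschitz_sat lo hi).comp (h1.comp h2))
  have h4 : ContDiff ℝ 1 fun p : (V × ℝ) × ℝ =>
      (A p.1.1 + p.2 • (B p.1.1 + b) + E, c p.1.1 - r) := by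
    fun_prop
  exact h4.locallyLipschitz.comp h3

theorem exists_norm_saturatedLoop_le (A B : V →L[ℝ] V) (b E : V) (c : V →L[ℝ] ℝ)
    {lo hi : ℝ} (hle : lo ≤ hi) (α κ r : ℝ) : ∃ K : ℝ, 0 < K ∧ ∀ p : V × ℝ,
      ‖(A p.1 + sat lo hi (α + κ * p.2) • (B p.1 + b) + E, c p.1 - r)‖ ≤ K * (1 + ‖p‖) := by
  let U := max |lo| |hi|
  have hU : 0 ≤ U := le_max_of_le_left (abs_nonneg _)
  refine ⟨‖A‖ + U * (‖B‖ + ‖b‖) + ‖E‖ + ‖c‖ + |r| + 1, by positivity, fun p => ?_⟩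
  have hp1 : ‖p.1‖ ≤ ‖p‖ := norm_fst_le p
  have hp0 := norm_nonneg p
  have hA : ‖A p.1‖ ≤ ‖A‖ * ‖p‖ := (A.le_opNorm p.1).trans (by gcongr)
  have hB : ‖B p.1‖ ≤ ‖B‖ * ‖p‖ := (B.le_opNorm p.1).trans (by gcongr)
  have hc : ‖c p.1‖ ≤ ‖c‖ * ‖p‖ := (c.le_opNorm p.1).trans (by gcongr)
  have hs : ‖sat lo hi (α + κ * p.2)‖ ≤ U := by
    have := sat_mem_Icc hle (α + κ * p.2)
    exact abs_le_max_abs_abs this.1 this.2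
  have e1 : 0 ≤ ‖A‖ := norm_nonneg _
  have e2 : 0 ≤ U * ‖B‖ := by positivity
  have e3 : 0 ≤ U * ‖b‖ := by positivity
  have e4 : 0 ≤ ‖E‖ := norm_nonneg _
  have e5 : 0 ≤ ‖c‖ := norm_nonneg _
  have e6 : 0 ≤ |r| := abs_nonneg _
  have e7 := mul_nonneg e3 hp0
  have e8 := mul_nonneg e4 hp0
  have e9 := mul_nonneg e6 hp0
  have e10 := mul_nonneg e1 hp0
  have e11 := mul_nonneg e2 hp0
  have e12 := mul_nonneg e5 hp0
  rw [Prod.norm_def]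
  refine max_le ?_ ?_
  · calc _ ≤ ‖A p.1‖ + ‖sat lo hi (α + κ * p.2)‖ *
          (‖B p.1‖ + ‖b‖) + ‖E‖ := by
          refine (norm_add_le _ _).trans ?_
          gcongr
          refine (norm_add_le _ _).trans ?_
          gcongr
          rw [norm_smul]
          gcongr
          exact norm_add_le _ _
      _ ≤ ‖A‖ * ‖p‖ + U * (‖B‖ * ‖p‖ + ‖b‖) + ‖E‖ := by gcongr
      _ ≤ _ := by linarith
  · calc _ ≤ ‖c p.1‖ + ‖r‖ := norm_sub_le _ _
      _ ≤ ‖c‖ * ‖p‖ + |r| := by rw [Real.norm_eq_abs r]; gcongr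
      _ ≤ _ := by linarith

theorem exists_isForwardSolution_saturatedLoop [ProperSpace V] (A B : V →L[ℝ] V) (b E : V)
    (c : V →L[ℝ] ℝ) {lo hi : ℝ} (hle : lo ≤ hi) (α κ r : ℝ) (x₀ : V × ℝ) :
    ∃ x : ℝ → V × ℝ, IsForwardSolution (fun p : V × ℝ =>
      (A p.1 + sat lo hi (α + κ * p.2) • (B p.1 + b) + E, c p.1 - r)) x ∧ x 0 = x₀ := by
  obtain ⟨K, hK, hgrow⟩ := exists_norm_saturatedLoop_le A B b E c hle α κ r
  exact exists_isForwardSolution_of_linear_growth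
    (locallyLipschitz_saturatedLoop A B b E c lo hi α κ r) hK hgrow x₀

end SaturatedLoop

/-! ### Quadratic forms against the sup norm -/

section MatrixBounds

variable {n : ℕ}

theorem sq_norm_le_dotProduct_self (x : Fin n → ℝ) : ‖x‖ ^ 2 ≤ x ⬝ᵥ x := by
  have h0 : 0 ≤ x ⬝ᵥ x := Finset.sum_nonneg fun i _ => mul_self_nonneg _
  have h : ‖x‖ ≤ Real.sqrt (x ⬝ᵥ x) := by
    rw [pi_norm_le_iff_of_nonneg (Real.sqrt_nonneg _)]
    intro i
    refine Real.abs_le_sqrt ?_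
    rw [sq]
    exact Finset.single_le_sum (f := fun i => x i * x i) (fun i _ => mul_self_nonneg _)
      (Finset.mem_univ i)
  calc ‖x‖ ^ 2 ≤ Real.sqrt (x ⬝ᵥ x) ^ 2 := by gcongr
    _ = x ⬝ᵥ x := Real.sq_sqrt h0

theorem dotProduct_mulVec_self_le (B : Matrix (Fin n) (Fin n) ℝ) (x : Fin n → ℝ) :
    (B *ᵥ x) ⬝ᵥ (B *ᵥ x) ≤
      ‖Matrix.toEuclideanCLM (n := Fin n) (𝕜 := ℝ) B‖ ^ 2 * (x ⬝ᵥ x) := by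
  have hnorm : ∀ y : Fin n → ℝ, y ⬝ᵥ y = ‖WithLp.toLp 2 y‖ ^ 2 := by
    intro y
    rw [EuclideanSpace.real_norm_sq_eq]
    simp [dotProduct, sq]
  have h := (Matrix.toEuclideanCLM (n := Fin n) (𝕜 := ℝ) B).le_opNorm (WithLp.toLp 2 x)
  rw [Matrix.toEuclideanCLM_toLp] at h
  rw [hnorm, hnorm, ← mul_pow]
  gcongr

/-- The form has a positive lower bound on the compact unit sphere; homogeneity extends it. -/
theorem Matrix.PosDef.exists_mul_sq_norm_le {P : Matrix (Fin n) (Fin n) ℝ} (hP : P.PosDef) :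
    ∃ q : ℝ, 0 < q ∧ ∀ x, q * ‖x‖ ^ 2 ≤ x ⬝ᵥ (P *ᵥ x) := by
  have hcont : Continuous fun x : Fin n → ℝ => x ⬝ᵥ (P *ᵥ x) :=
    continuous_id.dotProduct (continuous_const.matrix_mulVec continuous_id)
  have hpos : ∀ x : Fin n → ℝ, x ≠ 0 → 0 < x ⬝ᵥ (P *ᵥ x) := fun x hx => by
    simpa using hP.dotProduct_mulVec_pos hx
  obtain ⟨q, hq, hle⟩ := (isCompact_sphere (0 : Fin n → ℝ) 1).exists_forall_le'
    hcont.continuousOn (a := 0) (fun x hx => hpos x (by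
      rintro rfl
      simp at hx))
  refine ⟨q, hq, fun x => ?_⟩
  rcases eq_or_ne x 0 with rfl | hx
  · simp
  · have hx0 : ‖x‖ ≠ 0 := norm_ne_zero_iff.2 hx
    have h := hle (‖x‖⁻¹ • x) (by simp [norm_smul, hx0])
    rw [mulVec_smul, smul_dotProduct, dotProduct_smul, smul_eq_mul, smul_eq_mul] at h
    calc q * ‖x‖ ^ 2 ≤ (‖x‖⁻¹ * (‖x‖⁻¹ * (x ⬝ᵥ (P *ᵥ x)))) * ‖x‖ ^ 2 := by gcongr
      _ = x ⬝ᵥ (P *ᵥ x) := by field_simp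

end MatrixBounds

/-! ### Common Lyapunov matrix and steady-state map -/

namespace BilinearSystem

variable {n : ℕ} {S : BilinearSystem n}

theorem F_add_smul (u v : ℝ) : S.F u + v • S.B = S.F (u + v) := by
  rw [F, F, add_smul, add_assoc]

/-- Every `u ∈ 𝒰` lies within `(hi - lo)/2 ≤ max {|lo|, |hi|}` of the midpoint `u₀`, so `(u - u₀) B`
is a perturbation of norm at most `μ`, which the LMI at `u₀` tolerates. -/
theorem RobustStabilityLMI.exists_common_lyapunov (h : S.RobustStabilityLMI) (hle : S.lo ≤ S.hi) :
    ∃ (P : Matrix (Fin n) (Fin n) ℝ) (ε : ℝ), P.PosDef ∧ 0 < ε ∧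
      ∀ u ∈ Set.Icc S.lo S.hi, ∀ x, x ⬝ᵥ (P *ᵥ (S.F u *ᵥ x)) ≤ -ε * (x ⬝ᵥ x) := by
  obtain ⟨P, ν, ε, hP, hν, hε, hN⟩ := h ((S.lo + S.hi) / 2) ⟨by linarith, by linarith⟩
  refine ⟨P, ε, hP, hε, fun u hu x => ?_⟩
  set u₀ := (S.lo + S.hi) / 2 with hu₀
  have hPT : Pᵀ = P := (conjTranspose_eq_transpose_of_trivial P).symm.trans hP.isHermitian
  obtain ⟨v, hv⟩ : ∃ v, v = u - u₀ := ⟨_, rfl⟩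
  have hFu : S.F u *ᵥ x = S.F u₀ *ᵥ x + v • (S.B *ᵥ x) := by
    rw [← smul_mulVec, ← add_mulVec, F_add_smul, hv, add_sub_cancel]
  have hvM : v ^ 2 ≤ (max |S.lo| |S.hi|) ^ 2 := by
    rw [sq_le_sq, abs_of_nonneg (le_max_of_le_left (abs_nonneg S.lo)), abs_le]
    have h1 := le_max_left |S.lo| |S.hi|
    have h2 := le_max_right |S.lo| |S.hi|
    have h3 := neg_abs_le S.lo
    have h4 := le_abs_self S.hi
    constructor <;> rw [hv, hu₀] <;> linarith [hu.1, hu.2]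
  -- With second block `v B x`, the off-diagonal terms give `2 v xᵀ P B x`, and `-ν |v B x|²` is
  -- compensated by `ν μ² |x|²`.
  have hq := hN.dotProduct_mulVec_nonneg (Sum.elim x (v • (S.B *ᵥ x)))
  have hsymm : x ⬝ᵥ ((S.F u₀)ᵀ *ᵥ (P *ᵥ x)) = x ⬝ᵥ (P *ᵥ (S.F u₀ *ᵥ x)) := by
    rw [dotProduct_mulVec, vecMul_transpose, dotProduct_mulVec x P, ← mulVec_transpose, hPT,
      dotProduct_comm]
  have hsymm2 : (S.B *ᵥ x) ⬝ᵥ (P *ᵥ x) = x ⬝ᵥ (P *ᵥ (S.B *ᵥ x)) := by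
    rw [dotProduct_mulVec x P, ← mulVec_transpose, hPT, dotProduct_comm]
  have hB : v ^ 2 * ((S.B *ᵥ x) ⬝ᵥ (S.B *ᵥ x)) ≤ S.mu ^ 2 * (x ⬝ᵥ x) := by
    have h0 : 0 ≤ x ⬝ᵥ x := le_trans (by positivity) (sq_norm_le_dotProduct_self x)
    have h0' : 0 ≤ (S.B *ᵥ x) ⬝ᵥ (S.B *ᵥ x) :=
      le_trans (by positivity) (sq_norm_le_dotProduct_self _)
    rw [mu, mul_pow]
    calc _ ≤ (max |S.lo| |S.hi|) ^ 2 *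
          (‖Matrix.toEuclideanCLM (n := Fin n) (𝕜 := ℝ) S.B‖ ^ 2 * (x ⬝ᵥ x)) := by
          gcongr
          exact dotProduct_mulVec_self_le _ _
      _ = _ := by ring
  have hνB := mul_le_mul_of_nonneg_left hB hν.le
  rw [star_trivial, neg_mulVec, dotProduct_neg, fromBlocks_mulVec, sumElim_dotProduct_sumElim]
    at hq
  simp only [Sum.elim_comp_inl, Sum.elim_comp_inr, add_mulVec, neg_mulVec, smul_mulVec,
    one_mulVec, ← mulVec_mulVec, dotProduct_add, dotProduct_neg, dotProduct_smul,
    smul_dotProduct, mulVec_smul, smul_eq_mul, hsymm, hsymm2] at hq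
  rw [hFu, mulVec_add, mulVec_smul, dotProduct_add, dotProduct_smul, smul_eq_mul]
  linarith

theorem NonzeroGain.isUnit_F (h : S.NonzeroGain) {u : ℝ} (hu : u ∈ Set.Icc S.lo S.hi) :
    IsUnit (S.F u) := by
  have := (h u hu 0 ⟨by linarith [hu.1, hu.2], by linarith [hu.1, hu.2]⟩).1
  simpa using this

theorem inv_F_mulVec_cancel {u : ℝ} (hu : IsUnit (S.F u)) (x : Fin n → ℝ) :
    (S.F u)⁻¹ *ᵥ (S.F u *ᵥ x) = x := by
  rw [mulVec_mulVec, nonsing_inv_mul _ ((isUnit_iff_isUnit_det _).1 hu), one_mulVec]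

theorem F_mulVec_steadyState {u : ℝ} (hu : IsUnit (S.F u)) :
    S.F u *ᵥ S.steadyState u = -(u • S.b + S.E) := by
  rw [steadyState, mulVec_neg, mulVec_mulVec, mul_nonsing_inv _ ((isUnit_iff_isUnit_det _).1 hu),
    one_mulVec]

theorem steadyState_eq {u : ℝ} (hu : IsUnit (S.F u)) {x : Fin n → ℝ}
    (hx : S.F u *ᵥ x + u • S.b + S.E = 0) : x = S.steadyState u := by
  have h : S.F u *ᵥ x = -(u • S.b + S.E) := by
    rw [eq_neg_iff_add_eq_zero, ← add_assoc]; exact hx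
  rw [← inv_F_mulVec_cancel hu x, h, mulVec_neg, steadyState]

/-- Apply `F_w = F_u + (w - u) B` to both steady states. The formula is exact, so it gives the
derivative of `π` and finite increments alike. -/
theorem steadyState_sub {u w : ℝ} (hu : IsUnit (S.F u)) (hw : IsUnit (S.F w)) :
    S.steadyState w - S.steadyState u = -((w - u) • ((S.F w)⁻¹ *ᵥ S.g u)) := by
  have h1 : S.F w *ᵥ S.steadyState u =
      S.F u *ᵥ S.steadyState u + (w - u) • (S.B *ᵥ S.steadyState u) := by
    rw [← smul_mulVec, ← add_mulVec, F_add_smul, add_sub_cancel]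
  have h2 : S.F w *ᵥ (S.steadyState w - S.steadyState u) = -((w - u) • S.g u) := by
    rw [mulVec_sub, h1, F_mulVec_steadyState hu, F_mulVec_steadyState hw, g]
    module
  rw [← inv_F_mulVec_cancel hw (S.steadyState w - S.steadyState u), h2, mulVec_neg, mulVec_smul]

theorem continuous_F : Continuous S.F := by
  unfold F
  fun_prop

theorem continuousAt_inv_F {u : ℝ} (hu : IsUnit (S.F u)) :
    ContinuousAt (fun w => (S.F w)⁻¹) u := by
  have hdet : (S.F u).det ≠ 0 := ((isUnit_iff_isUnit_det _).1 hu).ne_zero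
  have h : ContinuousAt Inv.inv (S.F u) := by
    refine continuousAt_matrix_inv _ ?_
    rw [Ring.inverse_eq_inv']
    exact continuousAt_inv₀ hdet
  exact ContinuousAt.comp (f := S.F) h continuous_F.continuousAt

theorem NonzeroGain.continuousOn_inv_F (h : S.NonzeroGain) :
    ContinuousOn (fun w => (S.F w)⁻¹) (Set.Icc S.lo S.hi) := fun _ hu =>
  (continuousAt_inv_F (h.isUnit_F hu)).continuousWithinAt

theorem NonzeroGain.hasDerivWithinAt_steadyState (h : S.NonzeroGain) {u : ℝ}
    (hu : u ∈ Set.Icc S.lo S.hi) :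
    HasDerivWithinAt S.steadyState (-((S.F u)⁻¹ *ᵥ S.g u)) (Set.Icc S.lo S.hi) u := by
  rw [hasDerivWithinAt_iff_tendsto_slope]
  have h1 : Tendsto (fun w => -((S.F w)⁻¹ *ᵥ S.g u)) (𝓝[Set.Icc S.lo S.hi \ {u}] u)
      (𝓝 (-((S.F u)⁻¹ *ᵥ S.g u))) := by
    have : ContinuousAt (fun w => -((S.F w)⁻¹ *ᵥ S.g u)) u :=
      ((Continuous.matrix_mulVec continuous_id continuous_const).continuousAt.comp
        (f := fun w => (S.F w)⁻¹) (continuousAt_inv_F (h.isUnit_F hu))).neg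
    exact this.tendsto.mono_left nhdsWithin_le_nhds
  refine h1.congr' ?_
  filter_upwards [self_mem_nhdsWithin] with w hw
  have hne : w - u ≠ 0 := sub_ne_zero.2 hw.2
  rw [slope, vsub_eq_sub, steadyState_sub (h.isUnit_F hu) (h.isUnit_F hw.1), smul_neg, smul_smul,
    inv_mul_cancel₀ hne, one_smul]

theorem NonzeroGain.exists_norm_deriv_steadyState_le (h : S.NonzeroGain) :
    ∃ M : ℝ, ∀ u ∈ Set.Icc S.lo S.hi, ‖-((S.F u)⁻¹ *ᵥ S.g u)‖ ≤ M := by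
  have hπ : ContinuousOn S.steadyState (Set.Icc S.lo S.hi) := fun u hu =>
    (h.hasDerivWithinAt_steadyState hu).continuousWithinAt
  have hg : ContinuousOn S.g (Set.Icc S.lo S.hi) :=
    ((continuous_const.matrix_mulVec continuous_id).comp_continuousOn hπ).add continuousOn_const
  have hmul : Continuous fun p : Matrix (Fin n) (Fin n) ℝ × (Fin n → ℝ) => p.1 *ᵥ p.2 :=
    continuous_fst.matrix_mulVec continuous_snd
  exact isCompact_Icc.exists_bound_of_continuousOn
    (hmul.comp_continuousOn (h.continuousOn_inv_F.prodMk hg)).neg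

/-- The steady-state gain has the same sign for all input increments, and is bounded away
from zero. -/
theorem NonzeroGain.exists_le_sign_mul (h : S.NonzeroGain) {u : ℝ} (hu : u ∈ Set.Icc S.lo S.hi) :
    ∃ γ : ℝ, 0 < γ ∧ ∀ w ∈ Set.Icc S.lo S.hi,
      γ ≤ Real.sign (S.C ⬝ᵥ ((S.F u)⁻¹ *ᵥ S.g u)) * (S.C ⬝ᵥ ((S.F w)⁻¹ *ᵥ S.g u)) := by
  have hlohi := hu.1.trans hu.2
  let φ : ℝ → ℝ := fun w => S.C ⬝ᵥ ((S.F w)⁻¹ *ᵥ S.g u)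
  have hφ0 : ∀ w ∈ Set.Icc S.lo S.hi, φ w ≠ 0 := by
    intro w hw
    -- The increment `v = w - u` turns `F_u + v B` into `F_w`. A continuous nonvanishing function on
    -- an interval then keeps its sign, and compactness bounds it away from zero.
    have := (h u hu (w - u) ⟨by linarith [hu.2, hw.1], by linarith [hu.1, hw.2]⟩).2
    rwa [F_add_smul, add_sub_cancel] at this
  have hφc : ContinuousOn φ (Set.Icc S.lo S.hi) :=
    (Continuous.dotProduct continuous_const
      (continuous_id.matrix_mulVec continuous_const)).comp_continuousOn h.continuousOn_inv_F
  have hpos : ∀ w ∈ Set.Icc S.lo S.hi, 0 < Real.sign (φ u) * φ w := by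
    intro w hw
    have hconn := isPreconnected_Icc.image φ hφc
    have hzero : (0 : ℝ) ∉ φ '' Set.Icc S.lo S.hi := by
      rintro ⟨v, hv, hv0⟩
      exact hφ0 v hv hv0
    have hmem : ∀ v ∈ Set.Icc S.lo S.hi, φ v ∈ φ '' Set.Icc S.lo S.hi := fun v hv =>
      Set.mem_image_of_mem φ hv
    rcases lt_or_gt_of_ne (hφ0 u hu) with h1 | h1
    · rw [Real.sign_of_neg h1]
      by_contra! h2
      exact hzero (hconn.Icc_subset (hmem u hu) (hmem w hw) ⟨h1.le, by linarith⟩)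
    · rw [Real.sign_of_pos h1]
      by_contra! h2
      exact hzero (hconn.Icc_subset (hmem w hw) (hmem u hu) ⟨by linarith, h1.le⟩)
  obtain ⟨γ, hγ, hle⟩ := isCompact_Icc.exists_forall_le' (continuousOn_const.mul hφc) hpos
  exact ⟨γ, hγ, hle⟩

end BilinearSystem

/-! ### Stability of the closed loop -/

theorem theorem3 {n : ℕ} (S : BilinearSystem n)
    (hLMI : S.RobustStabilityLMI) (hgain : S.NonzeroGain)
    (r uss : ℝ) (xss : Fin n → ℝ) (huss : uss ∈ Set.Ioo S.lo S.hi)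
    (hreg : S.RegulatorEquations r xss uss) :
    ∃ kstar : ℝ, 0 < kstar ∧ ∀ k ∈ Set.Ioo 0 kstar,
      IsGloballyAsymptoticallyStable (S.closedLoop r uss k) (xss, 0) ∧
      IsLocallyExponentiallyStable (S.closedLoop r uss k) (xss, 0) := by
  have huss' : uss ∈ Set.Icc S.lo S.hi := ⟨huss.1.le, huss.2.le⟩
  have hle : S.lo ≤ S.hi := huss'.1.trans huss'.2
  have hxss : xss = S.steadyState uss :=
    BilinearSystem.steadyState_eq (hgain.isUnit_F huss') hreg.1
  obtain ⟨P, ε, hP, hε, hPF⟩ := hLMI.exists_common_lyapunov hle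
  obtain ⟨q, hq, hqP⟩ := hP.exists_mul_sq_norm_le
  obtain ⟨M, hM⟩ := hgain.exists_norm_deriv_steadyState_le
  obtain ⟨γ, hγ, hγle⟩ := hgain.exists_le_sign_mul huss'
  have hPT : Pᵀ = P := (conjTranspose_eq_transpose_of_trivial P).symm.trans hP.isHermitian
  have hG0 : ∀ u ∈ Set.Icc S.lo S.hi, ∀ x,
      S.A *ᵥ x + u • (S.B *ᵥ x + S.b) + S.E = S.F u *ᵥ (x - S.steadyState u) := by
    intro u hu x
    rw [mulVec_sub, BilinearSystem.F_mulVec_steadyState (hgain.isUnit_F hu), BilinearSystem.F,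
      add_mulVec, smul_mulVec]
    module
  set σ := Real.sign (S.C ⬝ᵥ ((S.F uss)⁻¹ *ᵥ S.g uss)) with hσdef
  have hσ : |σ| = 1 := by
    have h1 := hγle uss huss'
    have h2 : S.C ⬝ᵥ ((S.F uss)⁻¹ *ᵥ S.g uss) ≠ 0 := by
      intro h
      rw [h, mul_zero] at h1
      linarith
    rcases Real.sign_apply_eq_of_ne_zero _ h2 with h | h <;> rw [hσdef, h] <;> simp
  obtain ⟨kstar, hkstar, hstable⟩ := exists_gain_stable_slow_integral_control huss
    (toLinearMap₂' ℝ P).toContinuousBilinearMap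
    (by
      intro x y
      rw [LinearMap.toContinuousBilinearMap_apply, LinearMap.toContinuousBilinearMap_apply,
        toLinearMap₂'_apply', toLinearMap₂'_apply', dotProduct_mulVec, ← mulVec_transpose, hPT,
        dotProduct_comm])
    hq
    (by
      intro x
      rw [LinearMap.toContinuousBilinearMap_apply, toLinearMap₂'_apply']
      exact hqP x)
    (fun u x => S.A *ᵥ x + u • (S.B *ᵥ x + S.b) + S.E) S.steadyState
    (fun u => -((S.F u)⁻¹ *ᵥ S.g u))
    (LinearMap.toContinuousLinearMap (dotProductBilin ℝ ℝ S.C)) hε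
    (by
      intro u hu x
      rw [LinearMap.toContinuousBilinearMap_apply, toLinearMap₂'_apply', hG0 u hu]
      have h1 := sq_norm_le_dotProduct_self (x - S.steadyState u)
      have h2 := hPF u hu (x - S.steadyState u)
      -- The Euclidean decay rate passes to the sup norm because `‖x‖² ≤ x ⬝ᵥ x`.
      nlinarith)
    (by
      simp only [hG0 uss huss', sub_self, mulVec_zero])
    (fun u hu => hgain.hasDerivWithinAt_steadyState hu) hM hσ hγ
    (by
      intro u hu
      have h1 : S.C ⬝ᵥ S.steadyState u - S.C ⬝ᵥ S.steadyState uss =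
          -((u - uss) * (S.C ⬝ᵥ ((S.F u)⁻¹ *ᵥ S.g uss))) := by
        rw [← dotProduct_sub,
          BilinearSystem.steadyState_sub (hgain.isUnit_F huss') (hgain.isUnit_F hu),
          dotProduct_neg, dotProduct_smul, smul_eq_mul]
      change σ * (u - uss) * (S.C ⬝ᵥ S.steadyState u - S.C ⬝ᵥ S.steadyState uss) ≤ _
      rw [h1]
      have h2 := mul_le_mul_of_nonneg_right (hγle u hu) (sq_nonneg (u - uss))
      linarith)
  refine ⟨kstar, hkstar, fun k hk => ?_⟩
  rw [hxss]
  refine hstable k hk (S.closedLoop r uss k) ?_ ?_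
  · intro p
    have hr : r = S.C ⬝ᵥ S.steadyState uss := by rw [← hxss]; linarith [hreg.2]
    rw [BilinearSystem.closedLoop, hr]
    rfl
  · exact exists_isForwardSolution_saturatedLoop
      (LinearMap.toContinuousLinearMap S.A.mulVecLin)
      (LinearMap.toContinuousLinearMap S.B.mulVecLin) S.b S.E
      (LinearMap.toContinuousLinearMap (dotProductBilin ℝ ℝ S.C)) hle uss (σ * k) r
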